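/- Let $h(x)=-x\log x$ for $x\in(0,1]$, $h(0)=0$, $H(x)=h(x)+h(1-x)$, and \[ F(x,t)=\tfrac12 h(tx)+h\big((1-t)x\big)+\tfrac12 h\big(1-(2-t)x\big)-H(x). \] Let $d\ge 3$ be an integer and $F_d(x,t)=d\cdot F(x,t)+H(x)$. For $N$ with $Nd$ even, let $\mathbb{G}_{N,d}$ be the random $d$-regular multigraph (loops and multiple edges allowed) on $N$ vertices given by the configuration model: each vertex has $d$ half-edges, and a uniformly random pairing of the $Nd$ half-edges is chosen, each pair giving an edge between the vertices of its two half-edges. The average degree of a finite nonempty multigraph is $2|E|/|V|$. Suppose that $F_d(x_0,t_0)<0$ for some real numbers $0<x_0<t_0<1$. Then, with probability tending to $1$ as $N\to\infty$ (over $N$ with $Nd$ even), every induced subgraph of $\mathbb{G}_{N,d}$ on at least one and at most $x_0N$ vertices has average degree at most $t_0d$. -/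

import Mathlib

open Filter Topology MeasureTheory ProbabilityTheory

noncomputable section

namespace RandomRegular

/-- The function `H(x) = h(x) + h(1 - x)`, where `h(x) = -x log x` and `h(0) = 0`
(this `h` is `Real.negMulLog`). -/
def H (x : ℝ) : ℝ := Real.negMulLog x + Real.negMulLog (1 - x)

/-- `F(x,t) = h(tx)/2 + h((1-t)x) + h(1-(2-t)x)/2 - H(x)`. -/
def F (x t : ℝ) : ℝ :=
  1 / 2 * Real.negMulLog (t * x) + Real.negMulLog ((1 - t) * x)
    + 1 / 2 * Real.negMulLog (1 - (2 - t) * x) - H x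

/-- `F_d(x,t) = d F(x,t) + H(x)`. -/
def Fd (d : ℕ) (x t : ℝ) : ℝ := d * F x t + H x

/-- A pairing of the elements of `α`, given by the map that sends each element to its partner:
an involution without fixed points. -/
def Pairing (α : Type*) : Type _ :=
  {σ : Equiv.Perm α // ∀ a, σ (σ a) = a ∧ σ a ≠ a}

instance {α : Type*} [Finite α] : Finite (Pairing α) :=
  inferInstanceAs (Finite {σ : Equiv.Perm α // ∀ a, σ (σ a) = a ∧ σ a ≠ a})

instance {α : Type*} : MeasurableSpace (Pairing α) := ⊤

/-- The multigraph on `N` vertices produced by a pairing of the half-edges. The half-edges are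
the pairs `(v, i)` with `v` a vertex and `i < d`; the edges are the pairs `{a, σ a}` of matched
half-edges, and such an edge joins the vertices to which `a` and `σ a` belong. Loops and
multiple edges are possible. -/
def pairingGraph {N d : ℕ} (σ : Pairing (Fin N × Fin d)) :
    Graph (Fin N) (Sym2 (Fin N × Fin d)) where
  vertexSet := Set.univ
  IsLink e x y := ∃ a : Fin N × Fin d, e = s(a, σ.1 a) ∧ a.1 = x ∧ (σ.1 a).1 = y
  isLink_symm := by
    refine fun e _ => ⟨?_⟩
    rintro x y ⟨a, rfl, rfl, rfl⟩
    exact ⟨σ.1 a, by rw [(σ.2 a).1]; exact Sym2.eq_swap, rfl, by rw [(σ.2 a).1]⟩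
  eq_or_eq_of_isLink_of_isLink := by
    rintro e x y v w ⟨a, rfl, rfl, rfl⟩ ⟨b, hb, rfl, rfl⟩
    rcases Sym2.eq_iff.1 hb with ⟨h, -⟩ | ⟨h, -⟩
    · exact Or.inl (by rw [h])
    · exact Or.inr (by rw [h])
  left_mem_of_isLink := fun _ _ _ _ => Set.mem_univ _

/-- The configuration model: the law of a uniformly random pairing of the `N * d` half-edges
(a probability measure whenever `N * d` is even). The random multigraph with this law is
`pairingGraph σ`. -/
def configurationModel (N d : ℕ) : Measure (Pairing (Fin N × Fin d)) :=
  uniformOn Set.univ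

/-- The average degree `2|E| / |V|` of a finite nonempty multigraph (so a loop contributes `2`
to the degree of its vertex). -/
def averageDegree {V E : Type*} (G : Graph V E) : ℝ :=
  2 * (G.edgeSet.ncard : ℝ) / (G.vertexSet.ncard : ℝ)

end RandomRegular

end

/-!
The proof is a first-moment argument. Let `M = N d` be the number of half-edges. A set `U` of
`k = x N` vertices spans a subgraph of average degree more than `t₀ d` only if the set `S` of its
`K = k d` half-edges has at least `t₀ K` members whose partners are in `S` (`innerCount`).

*One set.* By symmetry, the probability that a random pairing has many inner pairs on a fixed `S`
is the proportion of `K`-subsets with many inner pairs for a fixed pairing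
(`Pairing.ncard_innerCount_mul_choose_le`). For a fixed pairing the generating function of subsets
by size and inner pairs is the power `(1 + 2y + (ys)²) ^ (M / 2)`, and Chernoff's bound with the
optimal weights gives at most `exp (M / 2 * pairEntropy x t₀)` such subsets. As `x ≤ t₀` the tilt
is towards more inner pairs, so that all proportions above `t₀` are covered at once.

*All sets of size `k`.* The union bound over `N.choose k ≤ exp (N H(x))` sets, divided by
`M.choose K`, which is `exp (M H(x))` up to a factor, gives `exp (N F_d(x, t₀))` up to that factor.
The factor is at most `M + 1` and also at most `exp K`; the latter serves for small `k`.

*The exponent.* The second derivative of `F_d(·, t₀)` has the sign of a decreasing affine function,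
the value at `0` is `0` and the value at `t₀` is `H(t₀) > 0`. So a negative value at `x₀` forces
`F_d(·, t₀)` to be negative on `(0, x₀]` and `d t₀ > 2` (`Fd_neg_of_le`). Since then
`F_d(x, t₀) / x → -∞` as `x → 0`, the expected number of dense `k`-sets tends to `0` for each fixed
`k` and has a bound, uniform in `N`, that is summable over `k`; dominated convergence finishes.
-/

namespace RandomRegular

/-! ### Counting inner pairs of a pairing -/

/-- The number of elements of `S` whose partner under the pairing `σ` also lies in `S`, that is,
twice the number of pairs inside `S`. -/
def innerCount {α : Type*} [DecidableEq α] (σ : Pairing α) (S : Finset α) : ℕ :=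
  (S.filter fun a => σ.1 a ∈ S).card

/-- Choosing one element from each pair presents a pairing as the flip of `β × Bool`. -/
lemma Pairing.exists_equiv_prod_bool.{u} {α : Type u} [Fintype α] (σ : Pairing α) :
    ∃ (β : Type u) (_ : Fintype β) (e : β × Bool ≃ α), ∀ b c, σ.1 (e (b, c)) = e (b, !c) := by
  -- The smaller element of each pair is chosen, in an arbitrary linear order.
  let _ : LinearOrder α := LinearOrder.lift' (Fintype.equivFin α) (Fintype.equivFin α).injective
  have hinv : ∀ a, σ.1 (σ.1 a) = a := fun a => (σ.2 a).1
  have hbij : Function.Bijective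
      (fun x : {a : α // a < σ.1 a} × Bool => if x.2 then σ.1 x.1.1 else x.1.1) := by
    constructor
    · rintro ⟨⟨a, ha⟩, c⟩ ⟨⟨b, hb⟩, c'⟩ h
      cases c <;> cases c' <;> simp at h
      · subst h; rfl
      · subst h
        rw [hinv] at ha
        exact absurd ha (not_lt.2 hb.le)
      · subst h
        rw [hinv] at hb
        exact absurd hb (not_lt.2 ha.le)
      · subst h; rfl
    · intro a
      rcases lt_trichotomy a (σ.1 a) with h | h | h
      · exact ⟨(⟨a, h⟩, false), by simp⟩
      · exact absurd h.symm (σ.2 a).2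
      · exact ⟨(⟨σ.1 a, by rwa [hinv]⟩, true), by simp [hinv]⟩
  refine ⟨_, inferInstance, Equiv.ofBijective _ hbij, fun b c => ?_⟩
  cases c <;> simp [hinv]

/-- A set of even size has a pairing. -/
lemma Pairing.nonempty_of_even_card {α : Type*} [Fintype α] (h : Even (Fintype.card α)) :
    Nonempty (Pairing α) := by
  obtain ⟨m, hm⟩ := h
  have e : Fin m × Bool ≃ α := Fintype.equivOfCardEq (by simp; omega)
  let g : Equiv.Perm (Fin m × Bool) := Equiv.prodCongr (Equiv.refl _) Equiv.boolNot
  refine ⟨⟨e.symm.trans (g.trans e), fun a => ?_⟩⟩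
  obtain ⟨⟨i, c⟩, rfl⟩ := e.surjective a
  simp [g]

/-- The generating function of the subsets of a paired set, by size and number of inner pairs:
each of the pairs contributes independently a factor for one of its four subsets. -/
lemma Pairing.sum_pow_card_mul_pow_innerCount {α : Type*} [DecidableEq α] [Fintype α]
    (σ : Pairing α) (y s : ℝ) {m : ℕ} (hm : Fintype.card α = 2 * m) :
    ∑ S : Finset α, y ^ S.card * s ^ innerCount σ S = (1 + 2 * y + (y * s) ^ 2) ^ m := by
  classical
  obtain ⟨β, _, e, he⟩ := σ.exists_equiv_prod_bool
  have hβ : Fintype.card β = m := by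
    have := Fintype.card_congr e
    simp at this
    omega
  let W : Finset Bool → ℝ := fun j => y ^ j.card * s ^ (j.filter fun c => (!c) ∈ j).card
  have hW : ∑ j, W j = 1 + 2 * y + (y * s) ^ 2 := by
    have : (Finset.univ : Finset (Finset Bool)) = {∅, {true}, {false}, {true, false}} := by
      decide
    rw [this, Finset.sum_insert (by decide), Finset.sum_insert (by decide),
      Finset.sum_insert (by decide), Finset.sum_singleton]
    have h1 : (({true} : Finset Bool).filter fun c => (!c) ∈ ({true} : Finset Bool)).card = 0 := by
      decide
    have h2 : (({false} : Finset Bool).filter fun c => (!c) ∈ ({false} : Finset Bool)).card = 0 := by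
      decide
    have h3 : (({true, false} : Finset Bool).filter
      fun c => (!c) ∈ ({true, false} : Finset Bool)).card = 2 := by decide
    simp only [W, h1, h2, h3]
    simp
    ring
  let φ : Finset α → β → Finset Bool := fun S b => Finset.univ.filter fun c => e (b, c) ∈ S
  have hφ : Function.Bijective φ := by
    constructor
    · intro S T h
      ext a
      obtain ⟨⟨b, c⟩, rfl⟩ := e.surjective a
      have := congrArg (c ∈ ·) (congrFun h b)
      simpa [φ] using this
    · intro x
      refine ⟨Finset.univ.filter fun a => (e.symm a).2 ∈ x (e.symm a).1, ?_⟩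
      ext b c
      simp [φ]
  have hcard : ∀ S : Finset α, S.card = ∑ b, (φ S b).card := by
    intro S
    have : S.card = ∑ a, if a ∈ S then 1 else 0 := by simp
    rw [this, ← e.sum_comp, Fintype.sum_prod_type]
    refine Finset.sum_congr rfl fun b _ => ?_
    rw [Finset.card_filter]
  have hinner : ∀ S : Finset α,
      innerCount σ S = ∑ b, ((φ S b).filter fun c => (!c) ∈ φ S b).card := by
    intro S
    have : innerCount σ S = ∑ a, if a ∈ S ∧ σ.1 a ∈ S then 1 else 0 := by
      rw [← Finset.card_filter, innerCount]
      congr 1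
      ext a
      simp
    rw [this, ← e.sum_comp, Fintype.sum_prod_type]
    refine Finset.sum_congr rfl fun b _ => ?_
    rw [← Finset.card_filter]
    congr 1
    ext c
    simp [φ, he]
  rw [← hW, ← hβ, ← Finset.card_univ, ← Finset.prod_const, Fintype.prod_sum]
  refine Fintype.sum_bijective φ hφ _ _ fun S => ?_
  rw [Finset.prod_mul_distrib, Finset.prod_pow_eq_pow_sum, Finset.prod_pow_eq_pow_sum,
    ← hcard, ← hinner]

/-- Chernoff's bound: few subsets of a paired set have many inner pairs. -/
lemma Pairing.card_filter_le_innerCount_mul_le {α : Type*} [DecidableEq α] [Fintype α]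
    (σ : Pairing α) {y s : ℝ} (hy : 0 ≤ y) (hs : 1 ≤ s) {m : ℕ} (hm : Fintype.card α = 2 * m)
    (K : ℕ) (θ : ℝ) :
    (((Finset.univ.powersetCard K).filter fun S => θ ≤ innerCount σ S).card : ℝ)
      * (y ^ K * s ^ θ) ≤ (1 + 2 * y + (y * s) ^ 2) ^ m := by
  rw [← σ.sum_pow_card_mul_pow_innerCount y s hm, ← nsmul_eq_mul]
  refine (Finset.card_nsmul_le_sum _ (fun S => y ^ S.card * s ^ innerCount σ S) _ ?_).trans
    (Finset.sum_le_univ_sum_of_nonneg fun S => by positivity)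
  intro S hS
  rw [Finset.mem_filter, Finset.mem_powersetCard] at hS
  rw [hS.1.2]
  gcongr
  rw [← Real.rpow_natCast]
  exact Real.rpow_le_rpow_of_exponent_le hs hS.2

/-- Conjugating a pairing by a permutation. -/
def Pairing.conj {α : Type*} (π : Equiv.Perm α) : Pairing α ≃ Pairing α where
  toFun σ := ⟨π.permCongr σ.1, fun a => by
    have h := σ.2 (π.symm a)
    exact ⟨by simp [h.1], fun h' => h.2 (π.injective (by simpa using h'))⟩⟩
  invFun σ := ⟨π.symm.permCongr σ.1, fun a => by
    have h := σ.2 (π a)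
    exact ⟨by simp [h.1], fun h' => h.2 (π.symm.injective (by simpa using h'))⟩⟩
  left_inv σ := Subtype.ext (by ext; simp)
  right_inv σ := Subtype.ext (by ext; simp)

lemma Pairing.conj_apply {α : Type*} (π : Equiv.Perm α) (σ : Pairing α) (a : α) :
    (Pairing.conj π σ).1 a = π (σ.1 (π.symm a)) := rfl

lemma Pairing.innerCount_conj {α : Type*} [DecidableEq α] (π : Equiv.Perm α) (σ : Pairing α)
    (S : Finset α) : innerCount (Pairing.conj π σ) (S.map π.toEmbedding) = innerCount σ S := by
  unfold innerCount
  rw [Finset.filter_map, Finset.card_map]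
  congr 1
  ext a
  simp [Pairing.conj_apply]

/-- By symmetry the law of `innerCount σ S` depends on `S` only through its size. -/
lemma Pairing.card_innerCount_eq_of_card_eq {α : Type*} [DecidableEq α] [Fintype α]
    {S T : Finset α} (h : S.card = T.card) (θ : ℝ) :
    {σ : Pairing α | θ ≤ innerCount σ S}.ncard = {σ : Pairing α | θ ≤ innerCount σ T}.ncard := by
  obtain ⟨π, hπ⟩ : ∃ π : Equiv.Perm α, S.map π.toEmbedding = T := by
    let e : {x // x ∈ S} ≃ {x // x ∈ T} := Fintype.equivOfCardEq (by simpa using h)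
    refine ⟨e.extendSubtype, Finset.eq_of_subset_of_card_le ?_ (by simp [h])⟩
    intro a ha
    obtain ⟨b, hb, rfl⟩ := Finset.mem_map.1 ha
    exact e.extendSubtype_mem b hb
  have hpre : {σ : Pairing α | θ ≤ innerCount σ S}
      = Pairing.conj π ⁻¹' {σ | θ ≤ innerCount σ T} := by
    ext σ
    simp only [Set.mem_ofPred_eq, Set.mem_preimage, ← hπ, Pairing.innerCount_conj]
  rw [hpre, Set.ncard_preimage_of_injective_subset_range (Pairing.conj π).injective (by simp)]

/-- Averaging over the sets of a given size exchanges a random pairing and a fixed set for a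
fixed pairing and a random set. -/
lemma Pairing.ncard_innerCount_mul_choose_le {α : Type*} [DecidableEq α] [Fintype α]
    {B : ℝ} {K : ℕ} {θ : ℝ}
    (hB : ∀ σ : Pairing α,
      (((Finset.univ.powersetCard K).filter fun S => θ ≤ innerCount σ S).card : ℝ) ≤ B)
    {S : Finset α} (hS : S.card = K) :
    ({σ : Pairing α | θ ≤ innerCount σ S}.ncard : ℝ) * (Fintype.card α).choose K
      ≤ Nat.card (Pairing α) * B := by
  classical
  have := Fintype.ofFinite (Pairing α)
  have hn : ∀ T : Finset α, {σ : Pairing α | θ ≤ innerCount σ T}.ncard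
      = (Finset.univ.filter fun σ : Pairing α => θ ≤ innerCount σ T).card := by
    intro T
    rw [← Set.ncard_coe_finset]
    congr 1
    ext σ
    simp
  have hdc := Finset.sum_card_bipartiteAbove_eq_sum_card_bipartiteBelow
    (s := (Finset.univ : Finset α).powersetCard K) (t := (Finset.univ : Finset (Pairing α)))
    (fun T σ => θ ≤ innerCount σ T)
  have h1 : ∑ T ∈ (Finset.univ : Finset α).powersetCard K,
      (Finset.univ.filter fun σ : Pairing α => θ ≤ innerCount σ T).card
      = (Fintype.card α).choose K * {σ : Pairing α | θ ≤ innerCount σ S}.ncard := by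
    rw [← Finset.card_univ, ← Finset.card_powersetCard, ← smul_eq_mul]
    refine Finset.sum_eq_card_nsmul fun T hT => ?_
    rw [← hn]
    exact Pairing.card_innerCount_eq_of_card_eq
      ((Finset.mem_powersetCard.1 hT).2.trans hS.symm) θ
  have h2 : ((∑ σ : Pairing α, ((Finset.univ.powersetCard K).filter
      fun S => θ ≤ innerCount σ S).card : ℕ) : ℝ) ≤ Nat.card (Pairing α) * B := by
    push_cast
    refine (Finset.sum_le_sum fun σ _ => hB σ).trans ?_
    simp
  have h3 := h1.symm.trans hdc
  calc _ = (((Fintype.card α).choose K * {σ : Pairing α | θ ≤ innerCount σ S}.ncard : ℕ) : ℝ) := by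
        push_cast; ring
    _ ≤ _ := by rw [h3]; exact h2

/-! ### Entropy bounds for binomial coefficients -/

lemma pow_le_choose_mul_pow {n k : ℕ} (h : k ≤ n) : n ^ k ≤ n.choose k * k ^ k := by
  induction k generalizing n with
  | zero => simp
  | succ k ih =>
    obtain ⟨n, rfl⟩ : ∃ m, n = m + 1 := ⟨n - 1, by omega⟩
    have hkn : k ≤ n := by omega
    have key : (n + 1) ^ k ≤ n.choose k * (k + 1) ^ k := by
      rcases Nat.eq_zero_or_pos k with rfl | hk
      · simp
      · refine Nat.le_of_mul_le_mul_right ?_ (pow_pos hk k)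
        calc (n + 1) ^ k * k ^ k = ((n + 1) * k) ^ k := (mul_pow _ _ _).symm
          _ ≤ (n * (k + 1)) ^ k := Nat.pow_le_pow_left (by nlinarith) k
          _ = n ^ k * (k + 1) ^ k := mul_pow _ _ _
          _ ≤ n.choose k * k ^ k * (k + 1) ^ k := Nat.mul_le_mul_right _ (ih hkn)
          _ = _ := by ring
    calc (n + 1) ^ (k + 1) = (n + 1) * (n + 1) ^ k := by ring
      _ ≤ (n + 1) * (n.choose k * (k + 1) ^ k) := Nat.mul_le_mul_left _ key
      _ = ((n + 1) * n.choose k) * (k + 1) ^ k := by ring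
      _ = (n + 1).choose (k + 1) * (k + 1) ^ (k + 1) := by
        rw [Nat.add_one_mul_choose_eq]; ring

/-- The binomial distribution with parameters `n` and `k / n` has its mode at `k`. -/
lemma choose_mul_pow_mul_pow_le {n k j : ℕ} (hk : 0 < k) (hkn : k < n) (hj : j ≤ n) :
    (n.choose j : ℝ) * k ^ j * (n - k) ^ (n - j) ≤ n.choose k * k ^ k * (n - k) ^ (n - k) := by
  set f : ℕ → ℝ := fun j => (n.choose j : ℝ) * k ^ j * (n - k) ^ (n - j) with hf
  have hq : (0 : ℝ) < n - k := by
    rw [sub_pos]; exact_mod_cast hkn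
  have hk' : (0 : ℝ) < k := by exact_mod_cast hk
  have hpos : ∀ j, 0 ≤ f j := fun j => by positivity
  have hrec : ∀ j, j < n → f (j + 1) * ((j + 1) * (n - k)) = f j * ((n - j) * k) := by
    intro j hj
    have h1 : (n.choose (j + 1) : ℝ) * (j + 1) = n.choose j * (n - j) := by
      have := Nat.choose_succ_right_eq n j
      rw [← Nat.cast_sub hj.le]
      exact_mod_cast this
    have h2 : n - j = (n - (j + 1)) + 1 := by omega
    simp only [hf]
    rw [h2, pow_succ, pow_succ]
    linear_combination (k ^ j * k * ((n : ℝ) - k) ^ (n - (j + 1)) * (n - k)) * h1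
  have hup : ∀ i, i ≤ k → f (k - i) ≤ f k := by
    intro i
    induction i with
    | zero => simp
    | succ i ih =>
      intro hi
      refine le_trans ?_ (ih (by omega))
      have hj : k - i = (k - (i + 1)) + 1 := by omega
      rw [hj]
      set j := k - (i + 1)
      have hjk : (j : ℝ) + 1 ≤ k := by
        have : j + 1 ≤ k := by omega
        exact_mod_cast this
      have h := hrec j (by omega)
      have hc : 0 < ((j : ℝ) + 1) * (n - k) := by positivity
      refine le_of_mul_le_mul_right ?_ hc
      rw [h]
      exact mul_le_mul_of_nonneg_left (by nlinarith) (hpos j)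
  have hdown : ∀ i, k + i ≤ n → f (k + i) ≤ f k := by
    intro i
    induction i with
    | zero => simp
    | succ i ih =>
      intro hi
      refine le_trans ?_ (ih (by omega))
      have h := hrec (k + i) (by omega)
      have hc : 0 < (((k + i : ℕ) : ℝ) + 1) * (n - k) := by positivity
      refine le_of_mul_le_mul_right ?_ hc
      rw [← add_assoc, h]
      refine mul_le_mul_of_nonneg_left ?_ (hpos _)
      push_cast
      have : (0 : ℝ) ≤ i := by positivity
      nlinarith
  rcases le_total j k with h | h
  · have := hup (k - j) (by omega)
    rwa [show k - (k - j) = j by omega] at this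
  · have := hdown (j - k) (by omega)
    rwa [show k + (j - k) = j by omega] at this

lemma exp_mul_H_mul {n k : ℕ} (hk : 0 < k) (hkn : k < n) :
    Real.exp (n * H (k / n)) * ((k : ℝ) ^ k * (n - k) ^ (n - k)) = (n : ℝ) ^ n := by
  have hq : (0 : ℝ) < n - k := by
    rw [sub_pos]; exact_mod_cast hkn
  have hk' : (0 : ℝ) < k := by exact_mod_cast hk
  have hn' : (0 : ℝ) < n := by exact_mod_cast hk.trans hkn
  have e1 : (k : ℝ) ^ k = Real.exp (k * Real.log k) := by
    rw [Real.exp_nat_mul, Real.exp_log hk']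
  have e2 : ((n : ℝ) - k) ^ (n - k) = Real.exp ((n - k) * Real.log (n - k)) := by
    rw [← Nat.cast_sub hkn.le, Real.exp_nat_mul, Real.exp_log (by rwa [Nat.cast_sub hkn.le])]
  have e3 : (n : ℝ) ^ n = Real.exp (n * Real.log n) := by
    rw [Real.exp_nat_mul, Real.exp_log hn']
  rw [e1, e2, e3, ← Real.exp_add, ← Real.exp_add]
  congr 1
  have hx : (1 : ℝ) - k / n = (n - k) / n := by field_simp
  rw [H, Real.negMulLog, Real.negMulLog, hx, Real.log_div hk'.ne' hn'.ne',
    Real.log_div hq.ne' hn'.ne']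
  field_simp
  ring

lemma choose_le_exp_mul_H {n k : ℕ} (hk : 0 < k) (hkn : k < n) :
    (n.choose k : ℝ) ≤ Real.exp (n * H (k / n)) := by
  have hq : (0 : ℝ) < n - k := by
    rw [sub_pos]; exact_mod_cast hkn
  have hk' : (0 : ℝ) < k := by exact_mod_cast hk
  have hc : 0 < (k : ℝ) ^ k * (n - k) ^ (n - k) := by positivity
  refine le_of_mul_le_mul_right ?_ hc
  rw [exp_mul_H_mul hk hkn]
  have := add_pow (k : ℝ) (n - k) n
  rw [show (k : ℝ) + (n - k) = n by ring] at this
  rw [this]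
  refine le_trans (le_of_eq ?_) (Finset.single_le_sum
    (f := fun m => (k : ℝ) ^ m * (n - k) ^ (n - m) * (n.choose m)) (fun i _ => by positivity)
    (Finset.mem_range.2 (Nat.lt_succ_of_lt hkn)))
  ring

/-- The largest of the `n + 1` terms of a binomial expansion is at least their average. -/
lemma exp_mul_H_le_mul_choose {n k : ℕ} (hk : 0 < k) (hkn : k < n) :
    Real.exp (n * H (k / n)) ≤ (n + 1) * n.choose k := by
  have hq : (0 : ℝ) < n - k := by
    rw [sub_pos]; exact_mod_cast hkn
  have hk' : (0 : ℝ) < k := by exact_mod_cast hk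
  have hc : 0 < (k : ℝ) ^ k * (n - k) ^ (n - k) := by positivity
  refine le_of_mul_le_mul_right ?_ hc
  rw [exp_mul_H_mul hk hkn]
  have := add_pow (k : ℝ) (n - k) n
  rw [show (k : ℝ) + (n - k) = n by ring] at this
  rw [this]
  refine (Finset.sum_le_card_nsmul _ _
    ((n.choose k : ℝ) * (k : ℝ) ^ k * ((n : ℝ) - k) ^ (n - k)) ?_).trans ?_
  · intro j hj
    refine le_trans (le_of_eq ?_)
      (choose_mul_pow_mul_pow_le hk hkn (Nat.lt_succ_iff.1 (Finset.mem_range.1 hj)))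
    ring
  · simp
    apply le_of_eq
    ring

/-- For `k` small against `n` this improves on `exp_mul_H_le_mul_choose`: the loss does not grow
with `n`. -/
lemma exp_mul_H_sub_le_choose {n k : ℕ} (hk : 0 < k) (hkn : k < n) :
    Real.exp (n * H (k / n) - k) ≤ n.choose k := by
  have hk' : (0 : ℝ) < k := by exact_mod_cast hk
  have hn' : (0 : ℝ) < n := by exact_mod_cast hk.trans hkn
  have hkn' : (k : ℝ) < n := by exact_mod_cast hkn
  have h1 : (n : ℝ) ^ k ≤ n.choose k * k ^ k := by exact_mod_cast pow_le_choose_mul_pow hkn.le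
  have h2 : Real.exp (n * Real.negMulLog (k / n)) * (k : ℝ) ^ k = (n : ℝ) ^ k := by
    have e1 : (k : ℝ) ^ k = Real.exp (k * Real.log k) := by
      rw [Real.exp_nat_mul, Real.exp_log hk']
    have e3 : (n : ℝ) ^ k = Real.exp (k * Real.log n) := by
      rw [Real.exp_nat_mul, Real.exp_log hn']
    rw [e1, e3, ← Real.exp_add]
    congr 1
    rw [Real.negMulLog, Real.log_div hk'.ne' hn'.ne']
    field_simp
    ring
  have h3 : Real.negMulLog (1 - k / n) ≤ k / n := by
    refine (Real.negMulLog_le_one_sub_self ?_).trans (by simp)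
    rw [sub_nonneg, div_le_one hn']
    exact hkn'.le
  have h4 : (n : ℝ) * H (k / n) - k ≤ n * Real.negMulLog (k / n) := by
    have : (n : ℝ) * Real.negMulLog (1 - k / n) ≤ n * (k / n) := by gcongr
    rw [mul_div_cancel₀ _ hn'.ne'] at this
    rw [H]
    linarith
  refine (Real.exp_le_exp.2 h4).trans ?_
  refine le_of_mul_le_mul_right ?_ (pow_pos hk' k)
  rw [h2]
  exact h1

/-! ### Counting subsets with many inner pairs: the entropy form -/

/-- The entropy of the pair of indicators of `S` at the two ends of a random pair, when `S` has
density `x` and a proportion `t` of `S` is paired inside `S`. -/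
noncomputable def pairEntropy (x t : ℝ) : ℝ :=
  Real.negMulLog (t * x) + 2 * Real.negMulLog ((1 - t) * x) + Real.negMulLog (1 - (2 - t) * x)

lemma Fd_eq (d : ℕ) (x t : ℝ) : Fd d x t = d / 2 * pairEntropy x t - (d - 1) * H x := by
  rw [Fd, F, pairEntropy]
  ring

lemma one_sub_two_sub_mul_pos {x t : ℝ} (hxt : x ≤ t) (ht : t < 1) : 0 < 1 - (2 - t) * x := by
  nlinarith [mul_pos (sub_pos.2 ht) (sub_pos.2 ht)]

/-- Chernoff's bound with optimal weights, for subsets of density `x` with a proportion at least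
`t ≥ x` paired inside. -/
lemma Pairing.card_filter_le_innerCount_le_exp {α : Type*} [DecidableEq α] [Fintype α]
    (σ : Pairing α) {m : ℕ} (hm : Fintype.card α = 2 * m) {x t : ℝ} (hx : 0 < x) (hxt : x ≤ t)
    (ht : t < 1) {K : ℕ} (hK : (K : ℝ) = 2 * m * x) :
    (((Finset.univ.powersetCard K).filter fun S => t * K ≤ innerCount σ S).card : ℝ)
      ≤ Real.exp (m * pairEntropy x t) := by
  -- The weights that tilt a uniform random subset to the extremal pair distribution `(p, q, q, r)`.
  set p := t * x with hp_def
  set q := (1 - t) * x with hq_def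
  set r := 1 - (2 - t) * x with hr_def
  have hp : 0 < p := mul_pos (hx.trans_le hxt) hx
  have hq : 0 < q := mul_pos (sub_pos.2 ht) hx
  have hr : 0 < r := one_sub_two_sub_mul_pos hxt ht
  have hsum : p + 2 * q + r = 1 := by rw [hp_def, hq_def, hr_def]; ring
  have hpr : q ^ 2 ≤ p * r := by
    have : p * r - q ^ 2 = x * (t - x) := by rw [hp_def, hq_def, hr_def]; ring
    nlinarith [mul_nonneg hx.le (sub_nonneg.2 hxt)]
  set s := √(p * r) / q with hs_def
  have hs : 1 ≤ s := by
    rw [hs_def, one_le_div hq]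
    exact Real.le_sqrt_of_sq_le hpr
  have hspos : 0 < s := by linarith
  have h := σ.card_filter_le_innerCount_mul_le (y := q / r) (s := s) (by positivity) hs hm K (t * K)
  have hbase : 1 + 2 * (q / r) + (q / r * s) ^ 2 = r⁻¹ := by
    have : q / r * s = √(p * r) / r := by rw [hs_def]; field_simp
    rw [this, div_pow, Real.sq_sqrt (by positivity)]
    field_simp
    linarith
  have hlogs : Real.log s = (Real.log p + Real.log r) / 2 - Real.log q := by
    rw [hs_def, Real.log_div (by positivity) hq.ne', Real.log_sqrt (by positivity),
      Real.log_mul hp.ne' hr.ne']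
  have hexp : Real.exp (m * pairEntropy x t) * ((q / r) ^ K * s ^ (t * K)) = (r⁻¹) ^ m := by
    have e1 : (q / r) ^ K = Real.exp (K * (Real.log q - Real.log r)) := by
      rw [Real.exp_nat_mul, ← Real.log_div hq.ne' hr.ne', Real.exp_log (by positivity)]
    have e2 : (r⁻¹) ^ m = Real.exp (m * (- Real.log r)) := by
      rw [Real.exp_nat_mul, ← Real.log_inv, Real.exp_log (by positivity)]
    rw [e1, e2, Real.rpow_def_of_pos hspos, hlogs, ← Real.exp_add, ← Real.exp_add, hK,
      pairEntropy, ← hp_def, ← hq_def, ← hr_def]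
    congr 1
    simp only [Real.negMulLog]
    linear_combination (m : ℝ) * (-Real.log p * hp_def - 2 * Real.log q * hq_def
      - Real.log r * hr_def)
  rw [hbase, ← hexp] at h
  exact le_of_mul_le_mul_right h (by positivity)

/-! ### The derivatives of the exponent -/

lemma continuous_Fd (d : ℕ) (t : ℝ) : Continuous fun x => Fd d x t := by
  unfold Fd F H
  fun_prop

lemma Fd_zero (d : ℕ) (t : ℝ) : Fd d 0 t = 0 := by
  simp [Fd, F, H]

/-- At `x = t` the two ends of a pair become independent. -/
lemma Fd_self {d : ℕ} {t : ℝ} : Fd d t t = H t := by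
  have h1 : Real.negMulLog (t * t) = 2 * t * Real.negMulLog t := by
    rw [Real.negMulLog_mul]; ring
  have h2 : Real.negMulLog (1 - (2 - t) * t) = 2 * (1 - t) * Real.negMulLog (1 - t) := by
    rw [show 1 - (2 - t) * t = (1 - t) * (1 - t) by ring, Real.negMulLog_mul]; ring
  rw [Fd, F, h1, h2, Real.negMulLog_mul, H]
  ring

lemma H_pos {x : ℝ} (h0 : 0 < x) (h1 : x < 1) : 0 < H x := by
  have a := Real.mul_log_neg h0 h1
  have b := Real.mul_log_neg (sub_pos.2 h1) (by linarith)
  rw [H, Real.negMulLog, Real.negMulLog]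
  linarith

lemma hasDerivAt_Fd (d : ℕ) {x t : ℝ} (hx : 0 < x) (hxt : x < t) (ht : t < 1) :
    HasDerivAt (fun x => Fd d x t)
      (d / 2 * (t * (-Real.log (t * x) - 1) + 2 * ((1 - t) * (-Real.log ((1 - t) * x) - 1))
        - (2 - t) * (-Real.log (1 - (2 - t) * x) - 1))
        - (d - 1) * ((-Real.log x - 1) - (-Real.log (1 - x) - 1))) x := by
  have hr := one_sub_two_sub_mul_pos hxt.le ht
  have hl : ∀ c : ℝ, HasDerivAt (fun x : ℝ => c * x) c x := fun c => by
    simpa using (hasDerivAt_id x).const_mul c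
  have h1 := (Real.hasDerivAt_negMulLog (x := t * x)
    (mul_pos (hx.trans hxt) hx).ne').comp x (hl t)
  have h2 := (Real.hasDerivAt_negMulLog (x := (1 - t) * x)
    (mul_pos (sub_pos.2 ht) hx).ne').comp x (hl (1 - t))
  have h3 := (Real.hasDerivAt_negMulLog hr.ne').comp x ((hl (2 - t)).const_sub 1)
  have h4 := Real.hasDerivAt_negMulLog hx.ne'
  have h5 := (Real.hasDerivAt_negMulLog (x := 1 - x) (by linarith)).comp x
    ((hasDerivAt_id x).const_sub 1)
  have := (((h1.add (h2.const_mul 2)).add h3).const_mul ((d : ℝ) / 2)).sub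
    ((h4.add h5).const_mul ((d : ℝ) - 1))
  refine (this.congr_of_eventuallyEq (Eventually.of_forall fun y => ?_)).congr_deriv ?_
  · rw [Fd_eq, pairEntropy, H]
    simp
  · ring

/-- The second derivative of `Fd d · t`, brought over a common denominator: the numerator is affine
in `x`. -/
lemma hasDerivAt_deriv_Fd (d : ℕ) {x t : ℝ} (hx : 0 < x) (hxt : x < t) (ht : t < 1) :
    HasDerivAt (fun x : ℝ =>
      (d / 2 * (t * (-Real.log (t * x) - 1) + 2 * ((1 - t) * (-Real.log ((1 - t) * x) - 1))
        - (2 - t) * (-Real.log (1 - (2 - t) * x) - 1))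
        - (d - 1) * ((-Real.log x - 1) - (-Real.log (1 - x) - 1))))
      ((d * t / 2 - 1 - (2 - t) * (d / 2 - 1) * x) / (x * (1 - x) * (1 - (2 - t) * x))) x := by
  have hr := one_sub_two_sub_mul_pos hxt.le ht
  have ht0 : 0 < t := hx.trans hxt
  have ht1 : 0 < 1 - t := sub_pos.2 ht
  have hx1 : 0 < 1 - x := by linarith
  have hl : ∀ c : ℝ, HasDerivAt (fun x : ℝ => c * x) c x := fun c => by
    simpa using (hasDerivAt_id x).const_mul c
  have h1 := ((hl t).log (by positivity)).neg.sub_const 1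
  have h2 := ((hl (1 - t)).log (by positivity)).neg.sub_const 1
  have h3 := (((hl (2 - t)).const_sub 1).log hr.ne').neg.sub_const 1
  have h4 := ((hasDerivAt_id x).log hx.ne').neg.sub_const 1
  have h5 := (((hasDerivAt_id x).const_sub 1).log hx1.ne').neg.sub_const 1
  have := ((((h1.const_mul t).add ((h2.const_mul (1 - t)).const_mul 2)).sub
    (h3.const_mul (2 - t))).const_mul ((d : ℝ) / 2)).sub ((h4.sub h5).const_mul ((d : ℝ) - 1))
  refine this.congr_deriv ?_
  simp only [id]
  set r := 1 - (2 - t) * x with hr_def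
  field_simp
  rw [hr_def]
  ring

/-! ### Sign and asymptotics of the exponent -/

lemma convexOn_Fd {d : ℕ} {u t : ℝ} (hd : 3 ≤ d) (hut : u ≤ t) (ht : t < 1)
    (h : (2 - t) * (d / 2 - 1) * u ≤ d * t / 2 - 1) :
    ConvexOn ℝ (Set.Icc 0 u) fun x => Fd d x t := by
  have hd' : (3 : ℝ) ≤ d := by exact_mod_cast hd
  refine convexOn_of_hasDerivWithinAt2_nonneg (convex_Icc _ _) (continuous_Fd d t).continuousOn
    (fun x hx => (hasDerivAt_Fd d ?_ ?_ ht).hasDerivWithinAt)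
    (fun x hx => (hasDerivAt_deriv_Fd d ?_ ?_ ht).hasDerivWithinAt) (fun x hx => ?_) <;>
    rw [interior_Icc] at hx
  · exact hx.1
  · exact hx.2.trans_le hut
  · exact hx.1
  · exact hx.2.trans_le hut
  · have hr := one_sub_two_sub_mul_pos (hx.2.le.trans hut) ht
    have hx1 : 0 < 1 - x := by linarith [hx.2]
    have hx0 := hx.1
    have hB : 0 < (2 - t) * ((d : ℝ) / 2 - 1) := mul_pos (by linarith) (by linarith)
    refine div_nonneg ?_ (by positivity)
    linarith [mul_le_mul_of_nonneg_left hx.2.le hB.le]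

lemma concaveOn_Fd {d : ℕ} {u t : ℝ} (hd : 3 ≤ d) (hu : 0 ≤ u) (ht : t < 1)
    (h : d * t / 2 - 1 ≤ (2 - t) * (d / 2 - 1) * u) :
    ConcaveOn ℝ (Set.Icc u t) fun x => Fd d x t := by
  have hd' : (3 : ℝ) ≤ d := by exact_mod_cast hd
  refine concaveOn_of_hasDerivWithinAt2_nonpos (convex_Icc _ _) (continuous_Fd d t).continuousOn
    (fun x hx => (hasDerivAt_Fd d ?_ ?_ ht).hasDerivWithinAt)
    (fun x hx => (hasDerivAt_deriv_Fd d ?_ ?_ ht).hasDerivWithinAt) (fun x hx => ?_) <;>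
    rw [interior_Icc] at hx
  · exact hu.trans_lt hx.1
  · exact hx.2
  · exact hu.trans_lt hx.1
  · exact hx.2
  · have hr := one_sub_two_sub_mul_pos hx.2.le ht
    have hx1 : 0 < 1 - x := by linarith [hx.2]
    have hx0 := hu.trans_lt hx.1
    have hB : 0 < (2 - t) * ((d : ℝ) / 2 - 1) := mul_pos (by linarith [hx.2]) (by linarith)
    refine div_nonpos_of_nonpos_of_nonneg ?_ (by positivity)
    linarith [mul_le_mul_of_nonneg_left hx.1.le hB.le]

/-- A single negative value of `Fd d · t` at `x₀ < t` makes the function negative on `(0, x₀]` and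
forces `d t > 2`: it vanishes at `0`, is positive at `t`, and is convex and then concave between,
the convex part being empty unless `d t > 2`. -/
lemma Fd_neg_of_le {d : ℕ} {x₀ t : ℝ} (hd : 3 ≤ d) (hx₀ : 0 < x₀) (hxt : x₀ < t) (ht : t < 1)
    (hF : Fd d x₀ t < 0) :
    0 < d * t / 2 - 1 ∧ ∀ x, 0 < x → x ≤ x₀ → Fd d x t < 0 := by
  have hd' : (3 : ℝ) ≤ d := by exact_mod_cast hd
  have hB : 0 < (2 - t) * ((d : ℝ) / 2 - 1) := mul_pos (by linarith) (by linarith)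
  have ht0 : 0 < Fd d t t := by
    rw [Fd_self]
    exact H_pos (hx₀.trans hxt) ht
  have hconvex : ∀ u, 0 < u → u ≤ t → (2 - t) * (d / 2 - 1) * u ≤ d * t / 2 - 1 → Fd d u t < 0 →
      ∀ x, 0 < x → x ≤ u → Fd d x t < 0 := by
    intro u hu hut h hFu x hx hxu
    have ha : 0 ≤ 1 - x / u := by
      rw [sub_nonneg, div_le_one hu]
      exact hxu
    have hb : 0 ≤ x / u := by positivity
    have := (convexOn_Fd hd hut ht h).2 (Set.left_mem_Icc.2 hu.le) (Set.right_mem_Icc.2 hu.le)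
      ha hb (by ring)
    simp only [smul_eq_mul, mul_zero, zero_add, Fd_zero] at this
    rw [div_mul_cancel₀ _ hu.ne'] at this
    exact this.trans_lt (mul_neg_of_pos_of_neg (by positivity) hFu)
  have hconcave : ∀ u, 0 ≤ u → u ≤ x₀ → d * t / 2 - 1 ≤ (2 - t) * (d / 2 - 1) * u →
      ∀ x, u ≤ x → x ≤ x₀ → Fd d x t < 0 := by
    intro u hu hux h x hx hxx
    by_contra! hcon
    have := (concaveOn_Fd hd hu ht h).min_le_of_mem_Icc ⟨hx, hxx.trans hxt.le⟩
      ⟨hux.trans hxt.le, le_rfl⟩ ⟨hxx, hxt.le⟩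
    exact absurd (this.trans_lt hF) (not_lt.2 (le_min hcon ht0.le))
  have hA : 0 < d * t / 2 - 1 := by
    by_contra! hcon
    have := hconcave 0 le_rfl hx₀.le (by simpa using hcon) 0 le_rfl hx₀.le
    rw [Fd_zero] at this
    exact lt_irrefl _ this
  refine ⟨hA, ?_⟩
  -- the inflection point
  set u := (d * t / 2 - 1) / ((2 - t) * ((d : ℝ) / 2 - 1)) with hu_def
  have hu : (2 - t) * (d / 2 - 1) * u = d * t / 2 - 1 := mul_div_cancel₀ _ hB.ne'
  have hu0 : 0 < u := div_pos hA hB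
  intro x hx hxx
  rcases le_total x₀ u with h | h
  · exact hconvex x₀ hx₀ hxt.le ((mul_le_mul_of_nonneg_left h hB.le).trans hu.le) hF x hx hxx
  · rcases le_total u x with h' | h'
    · exact hconcave u hu0.le h hu.ge x h' hxx
    · exact hconvex u hu0 (h.trans hxt.le) hu.le (hconcave u hu0.le h hu.ge u le_rfl h) x hx h'

/-- The behaviour of `Fd d · t` near `0`: the leading term is `(d t / 2 - 1) x log x`. -/
lemma Fd_le_mul_log_add {d : ℕ} {t : ℝ} (hd : 3 ≤ d) (ht0 : 0 < t) (ht : t < 1) :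
    ∃ C : ℝ, ∀ x, 0 < x → x ≤ t → Fd d x t ≤ x * ((d * t / 2 - 1) * Real.log x + C) := by
  have hd' : (3 : ℝ) ≤ d := by exact_mod_cast hd
  refine ⟨d / 2 * (Real.negMulLog t + 2 * Real.negMulLog (1 - t) + (2 - t)), fun x hx hxt => ?_⟩
  have hr := one_sub_two_sub_mul_pos hxt ht
  have h1 : Real.negMulLog (1 - (2 - t) * x) ≤ (2 - t) * x :=
    (Real.negMulLog_le_one_sub_self hr.le).trans (by linarith)
  have h2 : Real.negMulLog x ≤ H x := by
    have := Real.negMulLog_nonneg (x := 1 - x) (by linarith) (by linarith)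
    rw [H]; linarith
  have h3 := mul_le_mul_of_nonneg_left h1 (by positivity : (0 : ℝ) ≤ d / 2)
  have h4 := mul_le_mul_of_nonneg_left h2 (by linarith : (0 : ℝ) ≤ d - 1)
  rw [Fd_eq, pairEntropy, Real.negMulLog_mul, Real.negMulLog_mul]
  have h5 : Real.negMulLog x = - x * Real.log x := rfl
  rw [h5] at h4 ⊢
  nlinarith

/-- The bound on the expected number of dense sets of `k` vertices, for `1 ≤ k ≤ x₀ N`. The first
entry of the minimum is the better one for small `k`, the second for `k` of order `N`. Other values
of `k` are given the bound `0`, so that the sum over all `k` is the first moment bound. -/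
noncomputable def expectationBound (d : ℕ) (x₀ t : ℝ) (N k : ℕ) : ℝ :=
  if 1 ≤ k ∧ (k : ℝ) ≤ x₀ * N then
    min (Real.exp (N * Fd d (k / N) t + d * k)) ((N * d + 1) * Real.exp (N * Fd d (k / N) t))
  else 0

lemma expectationBound_nonneg (d : ℕ) (x₀ t : ℝ) (N k : ℕ) :
    0 ≤ expectationBound d x₀ t N k := by
  unfold expectationBound
  split_ifs
  · positivity
  · exact le_rfl

/-- A summable bound on the expectation, uniform in `N`. -/
lemma exists_expectationBound_le {d : ℕ} {x₀ t : ℝ} (hd : 3 ≤ d) (hx₀ : 0 < x₀) (hxt : x₀ < t)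
    (ht : t < 1) (hF : Fd d x₀ t < 0) :
    ∃ D c : ℝ, 0 < c ∧
      ∀ N k : ℕ, expectationBound d x₀ t N k ≤ (D * k + 1) * Real.exp (-c * k) := by
  obtain ⟨hA, hneg⟩ := Fd_neg_of_le hd hx₀ hxt ht hF
  obtain ⟨C, hC⟩ := Fd_le_mul_log_add hd (hx₀.trans hxt) ht
  have hd0 : (0 : ℝ) < d := by positivity
  -- below `ε` the logarithm beats every linear loss
  obtain ⟨ε, hε0, hεx, hε⟩ : ∃ ε : ℝ, 0 < ε ∧ ε ≤ x₀ ∧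
      ∀ x, 0 < x → x ≤ ε → Fd d x t ≤ x * (-(d + 1)) := by
    refine ⟨min x₀ (Real.exp (-(d + 1 + C) / (d * t / 2 - 1))), by positivity, min_le_left _ _, ?_⟩
    intro x hx hxε
    refine (hC x hx ((hxε.trans (min_le_left _ _)).trans hxt.le)).trans ?_
    refine mul_le_mul_of_nonneg_left ?_ hx.le
    have h1 : Real.log x ≤ -(d + 1 + C) / (d * t / 2 - 1) :=
      (Real.log_le_iff_le_exp hx).2 (hxε.trans (min_le_right _ _))
    rw [le_div_iff₀ hA] at h1
    linarith
  -- on `[ε, x₀]` compactness gives a linear upper bound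
  obtain ⟨z, hz, hmax⟩ := isCompact_Icc.exists_isMaxOn (Set.nonempty_Icc.2 hεx)
    (continuous_Fd d t).continuousOn
  have hFz : Fd d z t < 0 := hneg z (hε0.trans_le hz.1) hz.2
  set c := min 1 (-Fd d z t / x₀) with hc_def
  have hc : 0 < c := lt_min one_pos (div_pos (by linarith) hx₀)
  refine ⟨d / ε, c, hc, fun N k => ?_⟩
  unfold expectationBound
  split_ifs with h
  swap
  · positivity
  obtain ⟨hk1, hkN⟩ := h
  have hk : (0 : ℝ) < k := by exact_mod_cast hk1
  have hN : (0 : ℝ) < N := by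
    by_contra! hcon
    nlinarith
  have hx : 0 < (k : ℝ) / N := by positivity
  have hxx : (k : ℝ) / N ≤ x₀ := by rwa [div_le_iff₀ hN]
  have hNx : (N : ℝ) * (k / N) = k := mul_div_cancel₀ _ hN.ne'
  rcases le_total ((k : ℝ) / N) ε with h | h
  · refine (min_le_left _ _).trans ?_
    have h1 := mul_le_mul_of_nonneg_left (hε _ hx h) hN.le
    rw [← mul_assoc, hNx] at h1
    have h2 : c * k ≤ 1 * k := mul_le_mul_of_nonneg_right (min_le_left _ _) hk.le
    calc Real.exp (N * Fd d (k / N) t + d * k) ≤ 1 * Real.exp (-c * k) := by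
          rw [one_mul, Real.exp_le_exp]; linarith
      _ ≤ _ := by
        gcongr
        have : 0 ≤ d / ε * k := by positivity
        linarith
  · refine (min_le_right _ _).trans ?_
    have h1 : Fd d (k / N) t ≤ -c * (k / N) := by
      have h2 : Fd d (k / N) t ≤ Fd d z t := hmax ⟨h, hxx⟩
      have h3 : c * (k / N) ≤ (-Fd d z t / x₀) * x₀ :=
        mul_le_mul (min_le_right _ _) hxx hx.le (div_nonneg (by linarith) hx₀.le)
      rw [div_mul_cancel₀ _ hx₀.ne'] at h3
      linarith
    have h4 : (N : ℝ) * Fd d (k / N) t ≤ -c * k := by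
      calc (N : ℝ) * Fd d (k / N) t ≤ N * (-c * (k / N)) := by gcongr
        _ = -c * (N * (k / N)) := by ring
        _ = _ := by rw [hNx]
    have h5 : (N : ℝ) ≤ k / ε := by
      rw [le_div_iff₀ hε0]
      rw [le_div_iff₀ hN] at h
      linarith
    have h6 : (N : ℝ) * d ≤ d / ε * k := by
      calc (N : ℝ) * d ≤ k / ε * d := by gcongr
        _ = d / ε * k := by ring
    exact mul_le_mul (by linarith) (Real.exp_le_exp.2 h4) (Real.exp_pos _).le (by positivity)

lemma tendsto_expectationBound {d : ℕ} {x₀ t : ℝ} (hd : 3 ≤ d) (hx₀ : 0 < x₀) (hxt : x₀ < t)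
    (ht : t < 1) (hF : Fd d x₀ t < 0) (k : ℕ) :
    Tendsto (fun N => expectationBound d x₀ t N k) atTop (𝓝 0) := by
  obtain ⟨hA, -⟩ := Fd_neg_of_le hd hx₀ hxt ht hF
  obtain ⟨C, hC⟩ := Fd_le_mul_log_add hd (hx₀.trans hxt) ht
  rcases Nat.eq_zero_or_pos k with rfl | hk1
  · simp [expectationBound]
  have hk : (0 : ℝ) < k := by exact_mod_cast hk1
  have hlim : Tendsto (fun N : ℕ =>
      Real.exp (k * ((d * t / 2 - 1) * Real.log (k / N) + C + d))) atTop (𝓝 0) := by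
    refine Real.tendsto_exp_atBot.comp (Tendsto.const_mul_atBot hk
      (tendsto_atBot_add_const_right _ _ (tendsto_atBot_add_const_right _ _
        (Tendsto.const_mul_atBot hA ?_))))
    have h0 : Tendsto (fun N : ℕ => Real.log k - Real.log N) atTop atBot :=
      tendsto_atBot_add_const_left _ _
        (tendsto_neg_atTop_atBot.comp (Real.tendsto_log_atTop.comp tendsto_natCast_atTop_atTop))
    refine h0.congr' ?_
    filter_upwards [eventually_gt_atTop 0] with N hN
    rw [Real.log_div hk.ne' (by positivity)]
  refine squeeze_zero (fun N => expectationBound_nonneg _ _ _ _ _) (fun N => ?_) hlim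
  unfold expectationBound
  split_ifs with h
  swap
  · positivity
  obtain ⟨-, hkN⟩ := h
  have hN : (0 : ℝ) < N := by
    by_contra! hcon
    nlinarith
  have hNx : (N : ℝ) * (k / N) = k := mul_div_cancel₀ _ hN.ne'
  refine (min_le_left _ _).trans (Real.exp_le_exp.2 ?_)
  have h1 := mul_le_mul_of_nonneg_left (hC (k / N) (by positivity)
    (((div_le_iff₀ hN).2 hkN).trans hxt.le)) hN.le
  rw [← mul_assoc, hNx] at h1
  linarith

lemma summable_mul_add_one_mul_exp (D : ℝ) {c : ℝ} (hc : 0 < c) :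
    Summable fun k : ℕ => (D * k + 1) * Real.exp (-c * k) := by
  have h1 := (Real.summable_pow_mul_exp_neg_nat_mul 1 hc).mul_left D
  have h2 := Real.summable_pow_mul_exp_neg_nat_mul 0 hc
  refine (h1.add h2).congr fun k => ?_
  simp
  ring

/-- The first moment tends to `0`, by dominated convergence over the size `k`. -/
lemma tendsto_tsum_expectationBound {d : ℕ} {x₀ t : ℝ} (hd : 3 ≤ d) (hx₀ : 0 < x₀) (hxt : x₀ < t)
    (ht : t < 1) (hF : Fd d x₀ t < 0) :
    Tendsto (fun N => ∑' k, expectationBound d x₀ t N k) atTop (𝓝 0) := by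
  obtain ⟨D, c, hc, hle⟩ := exists_expectationBound_le hd hx₀ hxt ht hF
  rw [← tsum_zero (α := ℝ) (β := ℕ)]
  refine tendsto_tsum_of_dominated_convergence (summable_mul_add_one_mul_exp D hc)
    (tendsto_expectationBound hd hx₀ hxt ht hF) (Eventually.of_forall fun N k => ?_)
  rw [Real.norm_of_nonneg (expectationBound_nonneg _ _ _ _ _)]
  exact hle N k

lemma summable_expectationBound {d : ℕ} {x₀ t : ℝ} (hd : 3 ≤ d) (hx₀ : 0 < x₀) (hxt : x₀ < t)
    (ht : t < 1) (hF : Fd d x₀ t < 0) (N : ℕ) :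
    Summable fun k => expectationBound d x₀ t N k := by
  obtain ⟨D, c, hc, hle⟩ := exists_expectationBound_le hd hx₀ hxt ht hF
  exact Summable.of_nonneg_of_le (fun _ => expectationBound_nonneg _ _ _ _ _) (hle N)
    (summable_mul_add_one_mul_exp D hc)

/-! ### The union bound in the configuration model -/

lemma configurationModel_real {N d : ℕ} (A : Set (Pairing (Fin N × Fin d))) :
    (configurationModel N d).real A = A.ncard / Nat.card (Pairing (Fin N × Fin d)) := by
  classical
  have := Fintype.ofFinite (Pairing (Fin N × Fin d))
  rw [configurationModel, Measure.real, uniformOn_univ,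
    Measure.count_apply A.toFinite.measurableSet, ENNReal.toReal_div, ← A.toFinite.cast_ncard_eq, Nat.card_eq_fintype_card,
    ENat.toENNReal_coe, ENNReal.toReal_natCast, ENNReal.toReal_natCast]

/-- Every edge spanned by `U` uses two half-edges of `U` that are paired to each other. -/
lemma two_mul_ncard_edgeSet_induce_le {N d : ℕ} (σ : Pairing (Fin N × Fin d))
    (U : Finset (Fin N)) :
    2 * ((pairingGraph σ).induce (U : Set (Fin N))).edgeSet.ncard
      ≤ innerCount σ (U ×ˢ Finset.univ) := by
  set A := (U ×ˢ (Finset.univ : Finset (Fin d))).filter fun a => σ.1 a ∈ U ×ˢ Finset.univ with hA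
  have hE : ((pairingGraph σ).induce (U : Set (Fin N))).edgeSet
      = ((A.image fun a => s(a, σ.1 a) : Finset (Sym2 (Fin N × Fin d))) : Set _) := by
    ext e
    rw [Graph.edgeSet_induce]
    simp only [pairingGraph, Set.mem_ofPred_eq, Finset.coe_image, Set.mem_image]
    constructor
    · rintro ⟨x, y, ⟨a, rfl, rfl, rfl⟩, hx, hy⟩
      exact ⟨a, by simp_all, rfl⟩
    · rintro ⟨a, ha, rfl⟩
      simp only [hA, Finset.coe_filter, Finset.mem_product, Set.mem_ofPred_eq, Finset.mem_univ,
        and_true] at ha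
      exact ⟨a.1, (σ.1 a).1, ⟨a, rfl, rfl, rfl⟩, ha.1, ha.2⟩
  rw [hE, Set.ncard_coe_finset]
  change _ ≤ A.card
  rw [Finset.card_eq_sum_card_image (fun a => s(a, σ.1 a)) A, mul_comm, ← smul_eq_mul]
  -- The edge `s(a, σ a)` comes from the two distinct half-edges `a` and `σ a`.
  refine Finset.card_nsmul_le_sum _ _ _ fun e he => ?_
  obtain ⟨a, ha, rfl⟩ := Finset.mem_image.1 he
  have h := σ.2 a
  rw [← Finset.card_pair h.2.symm]
  refine Finset.card_le_card fun b hb => ?_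
  rw [Finset.mem_insert, Finset.mem_singleton] at hb
  rcases hb with rfl | rfl
  · simpa using ha
  · rw [Finset.mem_filter]
    refine ⟨?_, by rw [h.1]; exact Sym2.eq_swap⟩
    rw [hA, Finset.mem_filter] at ha ⊢
    exact ⟨ha.2, by rw [h.1]; exact ha.1⟩

lemma le_innerCount_of_lt_averageDegree {N d : ℕ} {t : ℝ} (σ : Pairing (Fin N × Fin d))
    {U : Finset (Fin N)} (hU : U.Nonempty)
    (h : t * d < averageDegree ((pairingGraph σ).induce (U : Set (Fin N)))) :
    t * ((U.card * d : ℕ) : ℝ) ≤ innerCount σ (U ×ˢ Finset.univ) := by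
  have hk : (0 : ℝ) < U.card := by exact_mod_cast hU.card_pos
  have hV : ((pairingGraph σ).induce (U : Set (Fin N))).vertexSet = (U : Set (Fin N)) := rfl
  rw [averageDegree, hV, Set.ncard_coe_finset, lt_div_iff₀ hk] at h
  have h1 : (2 * (((pairingGraph σ).induce (U : Set (Fin N))).edgeSet.ncard : ℝ))
      ≤ innerCount σ (U ×ˢ Finset.univ) := by
    exact_mod_cast two_mul_ncard_edgeSet_induce_le σ U
  push_cast
  linarith

lemma configurationModel_real_innerCount_mul_choose_le {N d : ℕ} (hNd : Even (N * d)) {x t : ℝ}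
    (hx : 0 < x) (hxt : x ≤ t) (ht : t < 1) {U : Finset (Fin N)} (hU : (U.card : ℝ) = N * x) :
    (configurationModel N d).real
        {σ | t * ((U.card * d : ℕ) : ℝ) ≤ innerCount σ (U ×ˢ Finset.univ)}
      * (N * d).choose (U.card * d) ≤ Real.exp (N * d / 2 * pairEntropy x t) := by
  obtain ⟨m, hm⟩ := hNd
  have hm' : (N : ℝ) * d = m + m := by exact_mod_cast hm
  have hcard : Fintype.card (Fin N × Fin d) = 2 * m := by
    simp
    omega
  have : Nonempty (Pairing (Fin N × Fin d)) :=
    Pairing.nonempty_of_even_card ⟨m, by rw [hcard]; ring⟩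
  have hpos : (0 : ℝ) < Nat.card (Pairing (Fin N × Fin d)) := by
    exact_mod_cast Nat.card_pos
  have h := Pairing.ncard_innerCount_mul_choose_le (K := U.card * d)
    (fun σ => σ.card_filter_le_innerCount_le_exp hcard hx hxt ht (K := U.card * d)
      (by push_cast; rw [hU]; linear_combination x * hm'))
    (S := U ×ˢ (Finset.univ : Finset (Fin d))) (by simp)
  rw [configurationModel_real, div_mul_eq_mul_div, div_le_iff₀ hpos, hm',
    show ((m : ℝ) + m) / 2 = m by ring]
  rw [show Fintype.card (Fin N × Fin d) = N * d by simp] at h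
  linarith

/-- The union bound over the sets of `k` vertices. -/
lemma sum_configurationModel_real_le_expectationBound {N d : ℕ} (hd : 3 ≤ d)
    (hNd : Even (N * d)) {x₀ t : ℝ} (hxt : x₀ < t) (ht : t < 1) {k : ℕ} (hk1 : 1 ≤ k)
    (hkN : (k : ℝ) ≤ x₀ * N) :
    ∑ U ∈ (Finset.univ : Finset (Fin N)).powersetCard k, (configurationModel N d).real
        {σ | t * ((U.card * d : ℕ) : ℝ) ≤ innerCount σ (U ×ˢ Finset.univ)}
      ≤ expectationBound d x₀ t N k := by
  have hk : (0 : ℝ) < k := by exact_mod_cast hk1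
  have hN : (0 : ℝ) < N := by
    refine lt_of_le_of_ne (Nat.cast_nonneg N) fun h => ?_
    rw [← h] at hkN
    linarith
  have hd0 : (0 : ℝ) < d := by positivity
  have hx : 0 < (k : ℝ) / N := by positivity
  have hxx : (k : ℝ) / N ≤ x₀ := (div_le_iff₀ hN).2 hkN
  have hkN' : k < N := by
    have : (k : ℝ) < N := by nlinarith
    exact_mod_cast this
  have hKpos : 0 < k * d := by positivity
  have hKM : k * d < N * d := Nat.mul_lt_mul_of_pos_right hkN' (by omega)
  have hdens : ((k * d : ℕ) : ℝ) / ((N * d : ℕ) : ℝ) = k / N := by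
    push_cast
    field_simp
  have hC : (0 : ℝ) < (N * d).choose (k * d) := by
    exact_mod_cast Nat.choose_pos hKM.le
  have hterm : ∀ U ∈ (Finset.univ : Finset (Fin N)).powersetCard k, (configurationModel N d).real
        {σ | t * ((U.card * d : ℕ) : ℝ) ≤ innerCount σ (U ×ˢ Finset.univ)}
      ≤ Real.exp (N * d / 2 * pairEntropy (k / N) t) / (N * d).choose (k * d) := by
    intro U hU
    have hcard := (Finset.mem_powersetCard.1 hU).2
    have h := configurationModel_real_innerCount_mul_choose_le hNd hx (hxx.trans hxt.le) ht
      (U := U) (by rw [hcard]; field_simp)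
    rw [hcard] at h ⊢
    rwa [le_div_iff₀ hC]
  have hsum := Finset.sum_le_card_nsmul _ _ _ hterm
  rw [Finset.card_powersetCard, Finset.card_univ, Fintype.card_fin, nsmul_eq_mul] at hsum
  have hchoose := choose_le_exp_mul_H hk1 hkN'
  have hFd : (N : ℝ) * Fd d (k / N) t
      = N * H (k / N) + N * d / 2 * pairEntropy (k / N) t - N * d * H (k / N) := by
    rw [Fd_eq]
    ring
  have hmain : (N.choose k : ℝ) * (Real.exp (N * d / 2 * pairEntropy (k / N) t)
      / (N * d).choose (k * d))
      ≤ Real.exp (N * Fd d (k / N) t) * Real.exp (N * d * H (k / N)) / (N * d).choose (k * d) := by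
    rw [← mul_div_assoc, hFd, ← Real.exp_add, sub_add_cancel, Real.exp_add]
    gcongr
  refine (hsum.trans hmain).trans ?_
  rw [expectationBound, if_pos ⟨hk1, hkN⟩]
  have hlow1 := exp_mul_H_sub_le_choose hKpos hKM
  have hlow2 := exp_mul_H_le_mul_choose hKpos hKM
  rw [hdens] at hlow1 hlow2
  push_cast at hlow1 hlow2
  refine le_min ?_ ?_
  · rw [div_le_iff₀ hC]
    calc Real.exp (N * Fd d (k / N) t) * Real.exp (N * d * H (k / N))
        = Real.exp (N * Fd d (k / N) t + d * k) * Real.exp (N * d * H (k / N) - k * d) := by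
          rw [← Real.exp_add, ← Real.exp_add]
          congr 1
          ring
      _ ≤ _ := by gcongr
  · rw [div_le_iff₀ hC]
    calc Real.exp (N * Fd d (k / N) t) * Real.exp (N * d * H (k / N))
        ≤ Real.exp (N * Fd d (k / N) t) * ((N * d + 1) * (N * d).choose (k * d)) := by gcongr
      _ = _ := by ring

end RandomRegular

theorem corollary3p4 (d : ℕ) (hd : 3 ≤ d) (x₀ t₀ : ℝ) (hx₀ : 0 < x₀) (hxt : x₀ < t₀)
    (ht₀ : t₀ < 1) (hF : RandomRegular.Fd d x₀ t₀ < 0) :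
    Tendsto
      (fun N : ℕ => (RandomRegular.configurationModel N d).real
        {σ | ∀ U : Finset (Fin N), U.Nonempty → (U.card : ℝ) ≤ x₀ * N →
          RandomRegular.averageDegree ((RandomRegular.pairingGraph σ).induce (U : Set (Fin N)))
            ≤ t₀ * d})
      (atTop ⊓ 𝓟 {N : ℕ | Even (N * d)}) (𝓝 1) := by
  have hlim : Tendsto (fun N : ℕ => 1 - ∑' k, RandomRegular.expectationBound d x₀ t₀ N k)
      (atTop ⊓ 𝓟 {N : ℕ | Even (N * d)}) (𝓝 1) := by
    have := (RandomRegular.tendsto_tsum_expectationBound hd hx₀ hxt ht₀ hF).const_sub 1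
    rw [sub_zero] at this
    exact this.mono_left inf_le_left
  have hprob : ∀ N : ℕ, Even (N * d) →
      IsProbabilityMeasure (RandomRegular.configurationModel N d) := by
    intro N hN
    have : Nonempty (RandomRegular.Pairing (Fin N × Fin d)) :=
      RandomRegular.Pairing.nonempty_of_even_card (by simpa using hN)
    exact instIsProbabilityMeasure_uniformOn_univ
  refine tendsto_of_tendsto_of_tendsto_of_le_of_le' hlim tendsto_const_nhds ?_ ?_
  swap
  · filter_upwards [mem_inf_of_right (mem_principal_self _)] with N hN
    have := hprob N hN
    exact measureReal_le_one
  filter_upwards [mem_inf_of_right (mem_principal_self _)] with N hN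
  have := hprob N hN
  set G : Set (RandomRegular.Pairing (Fin N × Fin d)) :=
    {σ | ∀ U : Finset (Fin N), U.Nonempty → (U.card : ℝ) ≤ x₀ * N →
      RandomRegular.averageDegree ((RandomRegular.pairingGraph σ).induce (U : Set (Fin N)))
        ≤ t₀ * d} with hG
  set A : Finset (Fin N) → Set (RandomRegular.Pairing (Fin N × Fin d)) := fun U =>
    {σ | t₀ * ((U.card * d : ℕ) : ℝ) ≤ RandomRegular.innerCount σ (U ×ˢ Finset.univ)}
  set I : Finset ℕ := (Finset.range (N + 1)).filter fun k => 1 ≤ k ∧ (k : ℝ) ≤ x₀ * N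
  have hsub : Gᶜ ⊆ ⋃ k ∈ I, ⋃ U ∈ (Finset.univ : Finset (Fin N)).powersetCard k, A U := by
    intro σ hσ
    simp only [hG, Set.mem_compl_iff, Set.mem_ofPred_eq] at hσ
    push Not at hσ
    obtain ⟨U, hU, hUN, hlt⟩ := hσ
    simp only [Set.mem_iUnion]
    refine ⟨U.card, ?_, U, by simp, RandomRegular.le_innerCount_of_lt_averageDegree σ hU hlt⟩
    rw [Finset.mem_filter, Finset.mem_range, Nat.lt_succ_iff]
    exact ⟨by simpa using U.card_le_univ, hU.card_pos, hUN⟩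
  have hcompl : (RandomRegular.configurationModel N d).real Gᶜ
      ≤ ∑' k, RandomRegular.expectationBound d x₀ t₀ N k := by
    calc (RandomRegular.configurationModel N d).real Gᶜ
        ≤ ∑ k ∈ I, ∑ U ∈ (Finset.univ : Finset (Fin N)).powersetCard k,
          (RandomRegular.configurationModel N d).real (A U) := by
          refine (measureReal_mono hsub (measure_ne_top _ _)).trans
            ((measureReal_biUnion_finset_le _ _).trans ?_)
          exact Finset.sum_le_sum fun k _ => measureReal_biUnion_finset_le _ _
      _ ≤ ∑ k ∈ I, RandomRegular.expectationBound d x₀ t₀ N k := by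
          refine Finset.sum_le_sum fun k hk => ?_
          obtain ⟨-, hk1, hkN⟩ := Finset.mem_filter.1 hk
          exact RandomRegular.sum_configurationModel_real_le_expectationBound hd hN hxt ht₀ hk1 hkN
      _ ≤ _ := (RandomRegular.summable_expectationBound hd hx₀ hxt ht₀ hF N).sum_le_tsum I
          fun k _ => RandomRegular.expectationBound_nonneg d x₀ t₀ N k
  rw [probReal_compl_eq_one_sub (Set.toFinite G).measurableSet] at hcompl
  linarith
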